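/- Let $G$ be a finite simple undirected graph. A *linkage* in $G$ is a subgraph whose connected components are paths (a single vertex counts as a path, with its two endpoints equal); its *order* is its number of components. For $\alpha,\beta\subseteq V(G)$, a linkage is an *$(\alpha,\beta)$-linkage* if $\alpha$ consists of one endpoint of each of its paths and $\beta$ consists of the other endpoints (a one-vertex path contributes its vertex to both sets). A linkage $\mathcal P$ is *rigid* if, for some $\alpha,\beta\subseteq V(G)$, $\mathcal P$ is the unique $(\alpha,\beta)$-linkage in $G$. Let $\operatorname{RL}(t)$ denote the maximum number of vertices in a rigid linkage of order $t$ in $G$ (with $\operatorname{RL}(t)=0$ if there is none, i.e. if $t>|V(G)|$). Let $\mathcal S(G)$ be the set of real symmetric matrices $A=[a_{uv}]$ with rows and columns indexed by $V(G)$ such that, for $u\neq v$, $a_{uv}\neq 0$ if and only if $uv$ is an edge of $G$ (the diagonal entries are arbitrary). For $A\in\mathcal S(G)$ let $q(A)$ be the number of distinct eigenvalues of $A$, for $j\ge 1$ let $q_j(A)$ be the number of distinct eigenvalues of $A$ of multiplicity at least $j$, and let $q(G)=\min\{q(A):A\in\mathcal S(G)\}$. **Theorem.** Let $t$ be a positive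 integer. Then 1. for every $A\in\mathcal S(G)$, $\displaystyle\sum_{j=1}^{t} q_j(A)\ \ge\ \operatorname{RL}(t)$; 2. $\displaystyle q(G)\ \ge\ \left\lceil \frac{\operatorname{RL}(t)}{t}\right\rceil$. -/

import Mathlib

namespace RigidLinkage

variable {V : Type*} {G : SimpleGraph V}

/-- The connected component `c` of the subgraph `P`, itself viewed as a subgraph of `G`. -/
def componentSubgraph (P : G.Subgraph) (c : P.coe.ConnectedComponent) : G.Subgraph :=
  P.induce (Subtype.val '' c.supp)

/-- The subgraph `H` is a path with endpoints `u` and `v`. A single vertex is a path, with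
`u = v`; otherwise `u` and `v` are the two distinct ends of the path. -/
def IsPathWithEnds (H : G.Subgraph) (u v : V) : Prop :=
  ∃ p : G.Walk u v, p.IsPath ∧ p.toSubgraph = H

/-- A linkage is a subgraph whose connected components are paths. -/
def IsLinkage (P : G.Subgraph) : Prop :=
  ∀ c : P.coe.ConnectedComponent, ∃ u v : V, IsPathWithEnds (componentSubgraph P c) u v

/-- The order of a linkage is its number of connected components. -/
noncomputable def order (P : G.Subgraph) : ℕ :=
  Nat.card P.coe.ConnectedComponent

/-- An `(α, β)`-linkage: every component is a path, `α` consists of one endpoint of each of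
these paths and `β` consists of the other endpoints (a one-vertex path puts its vertex in
both sets). -/
def IsLinkageBetween (P : G.Subgraph) (α β : Set V) : Prop :=
  ∃ a b : P.coe.ConnectedComponent → V,
    (∀ c, IsPathWithEnds (componentSubgraph P c) (a c) (b c)) ∧
      Set.range a = α ∧ Set.range b = β

/-- `P` is `(α, β)`-rigid: it is the unique `(α, β)`-linkage in `G`. -/
def IsRigidBetween (P : G.Subgraph) (α β : Set V) : Prop :=
  IsLinkageBetween P α β ∧ ∀ Q : G.Subgraph, IsLinkageBetween Q α β → Q = P

/-- `P` is a rigid linkage: it is `(α, β)`-rigid for some `α` and `β`. -/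
def IsRigid (P : G.Subgraph) : Prop :=
  IsLinkage P ∧ ∃ α β : Set V, IsRigidBetween P α β

/-- The numbers of vertices of the rigid linkages of order `t` in `G`. -/
def rigidSizes (G : SimpleGraph V) (t : ℕ) : Set ℕ :=
  {n | ∃ P : G.Subgraph, IsRigid P ∧ order P = t ∧ P.verts.ncard = n}

/-- The rigid linkage number `RL(t)`: the maximum number of vertices in a rigid linkage of
order `t`. On a finite graph the set of candidates is bounded; it is empty, and the value is
`0`, exactly when `t` exceeds the number of vertices. -/
noncomputable def RL (G : SimpleGraph V) (t : ℕ) : ℕ :=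
  sSup (rigidSizes G t)

theorem rigidSizes_bddAbove [Fintype V] (G : SimpleGraph V) (t : ℕ) :
    BddAbove (rigidSizes G t) := by
  refine ⟨Nat.card V, ?_⟩
  rintro n ⟨P, -, -, rfl⟩
  exact Set.ncard_le_card P.verts

/-- `S(G)`: the real symmetric matrices whose off-diagonal nonzero pattern is given by the
edges of `G`; the diagonal is unconstrained. -/
def symmetricMatrices (G : SimpleGraph V) : Set (Matrix V V ℝ) :=
  {A | A.IsSymm ∧ ∀ i j, i ≠ j → (A i j ≠ 0 ↔ G.Adj i j)}

theorem symmetricMatrices_nonempty (G : SimpleGraph V) : (symmetricMatrices G).Nonempty := by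
  classical
  refine ⟨G.adjMatrix ℝ, G.isSymm_adjMatrix, fun i j _ => ?_⟩
  simp [SimpleGraph.adjMatrix_apply]

variable [Fintype V]

/-- The multiplicity of `μ` as an eigenvalue of `A`: the dimension of `{x | A x = μ x}`. -/
noncomputable def mult (A : Matrix V V ℝ) (μ : ℝ) : ℕ :=
  Module.finrank ℝ (Module.End.eigenspace A.mulVecLin μ)

/-- `q(A)`: the number of distinct eigenvalues of `A`. -/
noncomputable def numEigenvalues (A : Matrix V V ℝ) : ℕ :=
  {μ : ℝ | Module.End.HasEigenvalue A.mulVecLin μ}.ncard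

/-- `q_i(A)`: the number of distinct eigenvalues of `A` of multiplicity at least `i`. -/
noncomputable def numEigenvaluesMultGE (A : Matrix V V ℝ) (i : ℕ) : ℕ :=
  {μ : ℝ | Module.End.HasEigenvalue A.mulVecLin μ ∧ i ≤ mult A μ}.ncard

/-- `q(G)`: the minimum of `q(A)` over `A` in `S(G)`. -/
noncomputable def minNumEigenvalues (G : SimpleGraph V) : ℕ :=
  sInf (numEigenvalues '' symmetricMatrices G)

end RigidLinkage

/-!
Let `P` be a rigid linkage of order `t` from `α` to `β`, given by disjoint paths from `a i` to
`b i`, and let `A ∈ S(G)` have size `n`. The bound comes from comparing degrees in the minor of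
`X - A` obtained by deleting the rows `β` and the columns `α`. The minor is realized, up to sign,
as the determinant of the full-size matrix `borderedCharmatrix`, in which each row `b i` is
replaced by the unit row at `a i`.

*The minor has degree `n - |P|`*
(`DisjointPaths.exists_natDegree_det_borderedCharmatrix`). A permutation contributing to the
determinant sends `b i` to `a i` and moves every other vertex along an edge or not at all. Following
it from `α` to the first vertex of `β` traces an `(α, β)`-linkage
(`exists_disjointPaths_of_perm`), which is `P` by rigidity; hence the permutation agrees with `P`
on all of `P` (`DisjointPaths.perm_getVert_of_rigid`). The degree of its contribution is the
number of its fixed points off `P`, and exactly one contributing permutation fixes all of them.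

*The minor has many real roots* (`sum_mult_sub_card_le_natDegree`). If `μ` has multiplicity `m`,
at least `m - t` independent eigenvectors for `μ` vanish on `α`, and the bordered matrix sends
them to multiples of `X - μ`; so `(X - μ) ^ (m - t)` divides the determinant.

Therefore the sum of `max (m - t) 0` over the eigenvalues is at most `n - |P|`. The
multiplicities of a symmetric matrix add up to `n`, so `|P|` is at most the sum of `min m t`,
which is both the sum of `q_j(A)` over `j ≤ t` and at most `t * q(A)`.
-/

namespace RigidLinkage

open Polynomial

variable {V : Type*} [Fintype V]

/-! ### Eigenvalue multiplicities -/

/-- The eigenvalues of `A` as a finite set. -/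
noncomputable def eigenvalueFinset (A : Matrix V V ℝ) : Finset ℝ :=
  (Module.End.finite_hasEigenvalue A.mulVecLin).toFinset

theorem mem_eigenvalueFinset {A : Matrix V V ℝ} {μ : ℝ} :
    μ ∈ eigenvalueFinset A ↔ Module.End.HasEigenvalue A.mulVecLin μ := by
  simp [eigenvalueFinset]

theorem numEigenvalues_eq_card (A : Matrix V V ℝ) :
    numEigenvalues A = (eigenvalueFinset A).card :=
  Set.ncard_eq_toFinset_card _ _

theorem numEigenvaluesMultGE_eq_card (A : Matrix V V ℝ) (j : ℕ) :
    numEigenvaluesMultGE A j = ((eigenvalueFinset A).filter (j ≤ mult A ·)).card := by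
  rw [numEigenvaluesMultGE, ← Set.ncard_coe_finset]
  congr 1
  ext μ
  simp [mem_eigenvalueFinset]

theorem sum_numEigenvaluesMultGE (A : Matrix V V ℝ) (t : ℕ) :
    ∑ j ∈ Finset.Icc 1 t, numEigenvaluesMultGE A j =
      ∑ μ ∈ eigenvalueFinset A, min (mult A μ) t := by
  simp_rw [numEigenvaluesMultGE_eq_card, Finset.card_filter]
  rw [Finset.sum_comm]
  refine Finset.sum_congr rfl fun μ _ => ?_
  rw [← Finset.card_filter]
  have : (Finset.Icc 1 t).filter (· ≤ mult A μ) = Finset.Icc 1 (min (mult A μ) t) := by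
    ext j
    simp only [Finset.mem_filter, Finset.mem_Icc, le_min_iff]
    tauto
  rw [this, Nat.card_Icc, Nat.add_sub_cancel]

/-- The eigenvalue multiplicities of a symmetric matrix add up to its size, since it has an
eigenvector basis. -/
theorem card_le_sum_mult {A : Matrix V V ℝ} (hA : A.IsSymm) :
    Fintype.card V ≤ ∑ μ ∈ eigenvalueFinset A, mult A μ := by
  classical
  have hH : A.IsHermitian := by
    rw [Matrix.IsHermitian, Matrix.conjTranspose_eq_transpose_of_trivial]; exact hA
  let b : V → V → ℝ := fun i => (hH.eigenvectorBasis i).ofLp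
  have hb : LinearIndependent ℝ b :=
    hH.eigenvectorBasis.orthonormal.linearIndependent.map'
      (WithLp.linearEquiv 2 ℝ (V → ℝ)).toLinearMap (LinearEquiv.ker _)
  have hmem : ∀ i, b i ∈ Module.End.eigenspace A.mulVecLin (hH.eigenvalues i) := fun i => by
    rw [Module.End.mem_eigenspace_iff]
    exact hH.mulVec_eigenvectorBasis i
  have hcard : ∀ μ, (Finset.univ.filter (hH.eigenvalues · = μ)).card ≤ mult A μ := fun μ => by
    let c : {i // hH.eigenvalues i = μ} → Module.End.eigenspace A.mulVecLin μ :=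
      fun i => ⟨b i, by have := hmem i; rwa [i.2] at this⟩
    have hc : LinearIndependent ℝ c := by
      refine LinearIndependent.of_comp (Submodule.subtype _) ?_
      exact hb.comp _ Subtype.val_injective
    rw [← Fintype.card_subtype]
    exact hc.fintype_card_le_finrank
  have hmaps : ∀ i ∈ (Finset.univ : Finset V), hH.eigenvalues i ∈ eigenvalueFinset A :=
    fun i _ => mem_eigenvalueFinset.2 <|
      Module.End.hasEigenvalue_of_hasEigenvector ⟨hmem i, hb.ne_zero i⟩
  rw [← Finset.card_univ, Finset.card_eq_sum_card_fiberwise hmaps]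
  exact Finset.sum_le_sum fun μ _ => hcard μ

/-! ### Divisibility of the determinant of a bordered characteristic matrix -/

/-- If a polynomial matrix sends every vector of a space `W` of scalar vectors to a multiple of
`q`, then `q ^ dim W` divides its determinant: after a scalar change of basis, `dim W` of the
columns are divisible by `q`. -/
theorem pow_finrank_dvd_det [DecidableEq V] (N : Matrix V V ℝ[X]) (q : ℝ[X])
    (W : Submodule ℝ (V → ℝ))
    (hW : ∀ x ∈ W, ∀ v, q ∣ N.mulVec (fun w => C (x w)) v) :
    q ^ Module.finrank ℝ W ∣ N.det := by
  obtain ⟨W', hc⟩ := W.exists_isCompl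
  let b := ((Module.finBasis ℝ W).prod (Module.finBasis ℝ W')).map
    (W.prodEquivOfIsCompl W' hc)
  let e : Fin (Module.finrank ℝ W) ⊕ Fin (Module.finrank ℝ W') ≃ V :=
    b.indexEquiv (Pi.basisFun ℝ V)
  let b' := b.reindex e
  have hb' : ∀ i, b' (e (Sum.inl i)) ∈ W := fun i => by
    simp [b', b, Module.Basis.prod_apply]
  let T : Matrix V V ℝ := (Pi.basisFun ℝ V).toMatrix b'
  have hTap : ∀ v j, T v j = b' j v := fun v j => by simp [T, Module.Basis.toMatrix_apply]
  have hTu : IsUnit T.det := by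
    have h := (Pi.basisFun ℝ V).toMatrix_mul_toMatrix_flip b'
    exact (Matrix.isUnit_iff_isUnit_det _).1 (IsUnit.of_mul_eq_one _ h)
  let d : V → ℝ[X] := fun j => Sum.elim (fun _ => q) (fun _ => 1) (e.symm j)
  have hcol : ∀ j v, d j ∣ (N * T.map C) v j := fun j v => by
    obtain ⟨i, rfl⟩ := e.surjective j
    rcases i with i | i
    · have h := hW _ (hb' i) v
      have h2 : (N * T.map C) v (e (Sum.inl i)) =
          N.mulVec (fun w => C (b' (e (Sum.inl i)) w)) v := by
        simp [Matrix.mul_apply, Matrix.mulVec, dotProduct, hTap]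
      rw [h2]
      simpa [d] using h
    · simp [d]
  choose R hR using hcol
  have h1 : N * T.map C = Matrix.of fun v j => d j * R j v := by
    ext1 v j
    exact hR j v
  have h2 : (N * T.map C).det = (∏ j, d j) * (Matrix.of fun v j => R j v).det := by
    rw [h1]
    exact Matrix.det_mul_row d (Matrix.of fun v j => R j v)
  have h3 : ∏ j, d j = q ^ Module.finrank ℝ W := by
    rw [← e.prod_comp]
    simp [d]
  have h4 : IsUnit (T.map C).det := by
    have : (T.map C).det = C T.det := (RingHom.map_det C T).symm
    rw [this]
    exact hTu.map C
  rw [← h3]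
  refine h4.dvd_mul_right.1 ?_
  rw [← Matrix.det_mul, h2]
  exact dvd_mul_right _ _

/-- The characteristic matrix `X - A` in which the row of each `v ∈ s` is replaced by the unit
row supported at `f v`. Its determinant is, up to sign, the minor of `X - A` with rows `s` and
columns `f '' s` deleted, when `f` is injective. -/
noncomputable def borderedCharmatrix [DecidableEq V] (A : Matrix V V ℝ) (s : Finset V)
    (f : V → V) : Matrix V V ℝ[X] :=
  Matrix.of fun v w => if v ∈ s then if w = f v then 1 else 0 else A.charmatrix v w

theorem X_sub_C_pow_dvd_det_borderedCharmatrix [DecidableEq V] (A : Matrix V V ℝ)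
    (s : Finset V) (f : V → V) (μ : ℝ) :
    (X - C μ) ^ (mult A μ - s.card) ∣ (borderedCharmatrix A s f).det := by
  let E := Module.End.eigenspace A.mulVecLin μ
  -- On eigenvectors vanishing on `f '' s`, the bordered matrix acts as `X - μ`.
  let g : E →ₗ[ℝ] (s → ℝ) :=
    (LinearMap.pi fun v : s => LinearMap.proj (f v)).comp E.subtype
  let W : Submodule ℝ (V → ℝ) := (LinearMap.ker g).map E.subtype
  have hrank : mult A μ - s.card ≤ Module.finrank ℝ W := by
    have h1 := g.finrank_range_add_finrank_ker
    have h2 : Module.finrank ℝ (LinearMap.range g) ≤ s.card := by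
      simpa using (LinearMap.range g).finrank_le
    have h3 : Module.finrank ℝ W = Module.finrank ℝ (LinearMap.ker g) :=
      Submodule.finrank_map_subtype_eq _ _
    have h4 : mult A μ = Module.finrank ℝ E := rfl
    omega
  refine (pow_dvd_pow _ hrank).trans (pow_finrank_dvd_det _ _ W ?_)
  rintro x ⟨y, hy, rfl⟩ v
  have hker : ∀ w ∈ s, y.1 (f w) = 0 := fun w hw => congrFun (LinearMap.mem_ker.1 hy) ⟨w, hw⟩
  have heig : A.mulVec y.1 = μ • y.1 := Module.End.mem_eigenspace_iff.1 y.2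
  by_cases hv : v ∈ s
  · have : (borderedCharmatrix A s f).mulVec (fun w => C (E.subtype y w)) v = 0 := by
      simp [borderedCharmatrix, Matrix.mulVec, dotProduct, hv, hker v hv]
    rw [this]
    exact dvd_zero _
  · have h1 : (borderedCharmatrix A s f).mulVec (fun w => C (E.subtype y w)) v =
        X * C (y.1 v) - C (A.mulVec y.1 v) := by
      simp [borderedCharmatrix, Matrix.mulVec, dotProduct, hv, Matrix.charmatrix_apply,
        sub_mul, Finset.sum_sub_distrib, Matrix.diagonal_apply]
    rw [h1, heig]
    refine ⟨C (y.1 v), ?_⟩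
    simp [sub_mul]

/-- The determinant of a bordered characteristic matrix, when nonzero, keeps every eigenvalue
of multiplicity `m` as a root of multiplicity at least `m - |s|`. -/
theorem sum_mult_sub_card_le_natDegree [DecidableEq V] (A : Matrix V V ℝ)
    (s : Finset V) (f : V → V) (h0 : (borderedCharmatrix A s f).det ≠ 0) :
    ∑ μ ∈ eigenvalueFinset A, (mult A μ - s.card) ≤ (borderedCharmatrix A s f).det.natDegree := by
  have hdvd : ∏ μ ∈ eigenvalueFinset A, (X - C μ) ^ (mult A μ - s.card) ∣
      (borderedCharmatrix A s f).det := by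
    refine Finset.prod_dvd_of_coprime ?_
      fun μ _ => X_sub_C_pow_dvd_det_borderedCharmatrix A s f μ
    intro μ _ ν _ hne
    exact (pairwise_coprime_X_sub_C (s := (id : ℝ → ℝ)) Function.injective_id hne).pow
  refine le_trans (le_of_eq ?_) (natDegree_le_of_dvd hdvd h0)
  rw [natDegree_prod_of_monic _ _ fun μ _ => (monic_X_sub_C μ).pow _]
  simp

end RigidLinkage

namespace RigidLinkage

variable {V : Type*} {G : SimpleGraph V}

/-! ### Linkages as families of disjoint paths -/

/-- A family of pairwise vertex-disjoint paths in `G`, the `i`-th one from `a i` to `b i`. -/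
structure DisjointPaths (G : SimpleGraph V) {ι : Type*} (a b : ι → V) where
  walk : ∀ i, G.Walk (a i) (b i)
  isPath : ∀ i, (walk i).IsPath
  disjoint : ∀ {i j v}, v ∈ (walk i).support → v ∈ (walk j).support → i = j

namespace DisjointPaths

variable {ι : Type*} {a b : ι → V} (D : DisjointPaths G a b)

/-- The union of the paths of the family. -/
def toSubgraph : G.Subgraph :=
  ⨆ i, (D.walk i).toSubgraph

theorem mem_verts {v : V} : v ∈ D.toSubgraph.verts ↔ ∃ i, v ∈ (D.walk i).support := by
  simp [toSubgraph]

theorem adj_iff {v w : V} : D.toSubgraph.Adj v w ↔ ∃ i, (D.walk i).toSubgraph.Adj v w := by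
  simp [toSubgraph]

theorem adj_of_mem {i : ι} {v w : V} (hv : v ∈ (D.walk i).support) (h : D.toSubgraph.Adj v w) :
    (D.walk i).toSubgraph.Adj v w := by
  obtain ⟨j, hj⟩ := D.adj_iff.1 h
  have hvj := (D.walk j).mem_verts_toSubgraph.1 hj.fst_mem
  rwa [D.disjoint hv hvj]

theorem start_injective (D : DisjointPaths G a b) : Function.Injective a := fun i j h =>
  D.disjoint (D.walk i).start_mem_support (by rw [h]; exact (D.walk j).start_mem_support)

theorem end_injective (D : DisjointPaths G a b) : Function.Injective b := fun i j h =>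
  D.disjoint (D.walk i).end_mem_support (by rw [h]; exact (D.walk j).end_mem_support)

/-- The component of the union that contains the `i`-th path. -/
def component (i : ι) : D.toSubgraph.coe.ConnectedComponent :=
  D.toSubgraph.coe.connectedComponentMk
    ⟨a i, D.mem_verts.2 ⟨i, (D.walk i).start_mem_support⟩⟩

theorem mk_eq_component_iff {v : V} (hv : v ∈ D.toSubgraph.verts) (i : ι) :
    D.toSubgraph.coe.connectedComponentMk ⟨v, hv⟩ = D.component i ↔
      v ∈ (D.walk i).support := by
  rw [component, SimpleGraph.ConnectedComponent.eq]
  constructor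
  · intro h
    obtain ⟨w⟩ := h.symm
    have key : ∀ {x y : D.toSubgraph.verts} (_ : D.toSubgraph.coe.Walk x y),
        x.1 ∈ (D.walk i).support → y.1 ∈ (D.walk i).support := by
      intro x y w
      induction w with
      | nil => exact id
      | cons h _ ih =>
        intro hx
        exact ih ((D.walk i).mem_verts_toSubgraph.1 (D.adj_of_mem hx h).snd_mem)
    exact key w (D.walk i).start_mem_support
  · intro h
    have hle : (D.walk i).toSubgraph ≤ D.toSubgraph :=
      le_iSup (fun i => (D.walk i).toSubgraph) i
    have hc := (D.walk i).toSubgraph_connected.preconnected.coe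
      ⟨v, (D.walk i).mem_verts_toSubgraph.2 h⟩ ⟨a i, (D.walk i).start_mem_verts_toSubgraph⟩
    exact hc.map (SimpleGraph.Subgraph.inclusion hle)

theorem component_injective : Function.Injective D.component := fun i j h =>
  D.disjoint (D.walk i).start_mem_support ((D.mk_eq_component_iff _ j).1 h)

theorem component_surjective : Function.Surjective D.component := fun c => by
  induction c using SimpleGraph.ConnectedComponent.ind with
  | h v =>
    obtain ⟨i, hi⟩ := D.mem_verts.1 v.2
    exact ⟨i, ((D.mk_eq_component_iff v.2 i).2 hi).symm⟩

theorem componentSubgraph_component (i : ι) :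
    componentSubgraph D.toSubgraph (D.component i) = (D.walk i).toSubgraph := by
  have hmem : ∀ v, v ∈ Subtype.val '' (D.component i).supp ↔ v ∈ (D.walk i).support := by
    intro v
    constructor
    · rintro ⟨w, hw, rfl⟩
      exact (D.mk_eq_component_iff w.2 i).1 hw
    · intro hv
      have hv' := D.mem_verts.2 ⟨i, hv⟩
      exact ⟨⟨v, hv'⟩, (D.mk_eq_component_iff hv' i).2 hv, rfl⟩
  refine SimpleGraph.Subgraph.ext ?_ ?_
  · ext v
    rw [SimpleGraph.Walk.mem_verts_toSubgraph, ← hmem]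
    rfl
  · ext v w
    simp only [componentSubgraph, SimpleGraph.Subgraph.induce_adj, hmem]
    constructor
    · rintro ⟨hv, -, h⟩
      exact D.adj_of_mem hv h
    · intro h
      exact ⟨(D.walk i).mem_verts_toSubgraph.1 h.fst_mem,
        (D.walk i).mem_verts_toSubgraph.1 h.snd_mem, D.adj_iff.2 ⟨i, h⟩⟩

theorem isLinkageBetween : IsLinkageBetween D.toSubgraph (Set.range a) (Set.range b) := by
  let e : ι ≃ D.toSubgraph.coe.ConnectedComponent :=
    Equiv.ofBijective D.component ⟨D.component_injective, D.component_surjective⟩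
  refine ⟨a ∘ e.symm, b ∘ e.symm, fun c => ?_, ?_, ?_⟩
  · obtain ⟨i, rfl⟩ := e.surjective c
    simp only [Function.comp_apply, Equiv.symm_apply_apply]
    exact ⟨D.walk i, D.isPath i, (D.componentSubgraph_component i).symm⟩
  · rw [e.symm.surjective.range_comp]
  · rw [e.symm.surjective.range_comp]

end DisjointPaths

theorem IsLinkageBetween.exists_disjointPaths {P : G.Subgraph} {α β : Set V}
    (h : IsLinkageBetween P α β) :
    ∃ (a b : P.coe.ConnectedComponent → V) (D : DisjointPaths G a b),
      D.toSubgraph = P ∧ Set.range a = α ∧ Set.range b = β := by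
  obtain ⟨a, b, hpath, ha, hb⟩ := h
  choose p hp hps using hpath
  have hmem : ∀ c v, v ∈ (p c).support ↔
      ∃ hv : v ∈ P.verts, P.coe.connectedComponentMk ⟨v, hv⟩ = c := by
    intro c v
    rw [← SimpleGraph.Walk.mem_verts_toSubgraph, hps]
    change v ∈ Subtype.val '' c.supp ↔ _
    constructor
    · rintro ⟨w, hw, rfl⟩
      exact ⟨w.2, hw⟩
    · rintro ⟨hv, h⟩
      exact ⟨⟨v, hv⟩, h, rfl⟩
  refine ⟨a, b, ⟨p, hp, fun {i j v} hi hj => ?_⟩, ?_, ha, hb⟩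
  · obtain ⟨_, rfl⟩ := (hmem _ _).1 hi
    obtain ⟨_, rfl⟩ := (hmem _ _).1 hj
    rfl
  · refine SimpleGraph.Subgraph.ext ?_ ?_
    · ext v
      rw [DisjointPaths.mem_verts]
      simp only [hmem]
      exact ⟨fun ⟨_, hv, _⟩ => hv, fun hv => ⟨_, hv, rfl⟩⟩
    · ext v w
      rw [DisjointPaths.adj_iff]
      simp only [hps, componentSubgraph, SimpleGraph.Subgraph.induce_adj]
      constructor
      · rintro ⟨_, _, _, h⟩
        exact h
      · intro h
        refine ⟨P.coe.connectedComponentMk ⟨v, h.fst_mem⟩, ⟨_, rfl, rfl⟩,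
          ⟨⟨w, h.snd_mem⟩, ?_, rfl⟩, h⟩
        exact SimpleGraph.ConnectedComponent.sound
          (SimpleGraph.Adj.reachable (G := P.coe) h.symm)

end RigidLinkage

namespace RigidLinkage

variable {V : Type*} {G : SimpleGraph V}

namespace DisjointPaths

variable {ι : Type*} {a b : ι → V} (D : DisjointPaths G a b)

/-! ### The permutation that closes up a family of disjoint paths -/

/-- Joining the end of every path to its start turns the family into disjoint cycles, hence into
a permutation fixing all vertices outside the family. -/
theorem exists_closingPerm [Finite V] :
    ∃ π : Equiv.Perm V, (∀ i, π (b i) = a i) ∧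
      (∀ i k, k < (D.walk i).length →
        π ((D.walk i).getVert k) = (D.walk i).getVert (k + 1)) ∧
      ∀ v, (∀ i, v ∉ (D.walk i).support) → π v = v := by
  classical
  let f : V → V := fun v =>
    if h : ∃ i, v ∈ (D.walk i).support then (D.walk h.choose).support.formPerm v else v
  have hf : ∀ {i v}, v ∈ (D.walk i).support → f v = (D.walk i).support.formPerm v := by
    intro i v hv
    have h : ∃ i, v ∈ (D.walk i).support := ⟨i, hv⟩
    simp only [f, dif_pos h]
    rw [D.disjoint h.choose_spec hv]
  have hf' : ∀ {v}, (∀ i, v ∉ (D.walk i).support) → f v = v := by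
    intro v hv
    exact dif_neg fun ⟨i, hi⟩ => hv i hi
  have hmem : ∀ {i v}, v ∈ (D.walk i).support → f v ∈ (D.walk i).support := by
    intro i v hv
    rw [hf hv]
    exact List.formPerm_apply_mem_of_mem hv
  have hinj : Function.Injective f := by
    intro v w h
    by_cases hv : ∃ i, v ∈ (D.walk i).support
    · obtain ⟨i, hi⟩ := hv
      by_cases hw : ∃ j, w ∈ (D.walk j).support
      · obtain ⟨j, hj⟩ := hw
        obtain rfl := D.disjoint (h ▸ hmem hi) (hmem hj)
        rw [hf hi, hf hj] at h
        exact Equiv.injective _ h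
      · push Not at hw
        rw [hf' hw] at h
        exact absurd (h ▸ hmem hi) (hw i)
    · push Not at hv
      by_cases hw : ∃ j, w ∈ (D.walk j).support
      · obtain ⟨j, hj⟩ := hw
        rw [hf' hv] at h
        exact absurd (h ▸ hmem hj) (hv j)
      · push Not at hw
        rwa [hf' hv, hf' hw] at h
  refine ⟨Equiv.ofBijective f (Finite.injective_iff_bijective.1 hinj), fun i => ?_,
    fun i k hk => ?_, fun v hv => hf' hv⟩
  · change f (b i) = a i
    rw [hf (D.walk i).end_mem_support]
    have h := List.formPerm_apply_getLast (a i) (D.walk i).support.tail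
    simpa only [SimpleGraph.Walk.cons_tail_support, SimpleGraph.Walk.getLast_support] using h
  · change f ((D.walk i).getVert k) = _
    rw [hf ((D.walk i).getVert_mem_support k)]
    have h := List.formPerm_apply_lt_getElem _ (D.isPath i).support_nodup k
      (by rw [SimpleGraph.Walk.length_support]; omega)
    simpa only [SimpleGraph.Walk.support_getElem_eq_getVert] using h

/-! ### The linkage traced out by a permutation -/

theorem _root_.SimpleGraph.exists_walk_iterate (f : V → V) (k : ℕ) (v : V)
    (h : ∀ i < k, G.Adj (f^[i] v) (f^[i + 1] v)) :
    ∃ p : G.Walk v (f^[k] v), p.length = k ∧ ∀ i ≤ k, p.getVert i = f^[i] v := by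
  induction k generalizing v with
  | zero => exact ⟨.nil, rfl, fun i hi => by simp [Nat.le_zero.1 hi]⟩
  | succ k ih =>
    obtain ⟨p, hp, hg⟩ := ih (f v) fun i hi => h (i + 1) (by omega)
    refine ⟨.cons (h 0 (by omega)) p, congrArg (· + 1) hp, fun i hi => ?_⟩
    cases i with
    | zero => rfl
    | succ i => exact hg i (by omega)

/-- A permutation that sends each `b i` to `a i` and moves every other vertex along an edge or
not at all traces out, from each `a i` to the first vertex in the range of `b`, a family of
disjoint paths. -/
theorem _root_.RigidLinkage.exists_disjointPaths_of_perm [Finite ι] [Finite V]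
    (ha : Function.Injective a) (σ : Equiv.Perm V)
    (hσ : ∀ i, σ (b i) = a i)
    (hadj : ∀ v, v ∉ Set.range b → σ v = v ∨ G.Adj v (σ v)) :
    ∃ (b' : ι → V) (D : DisjointPaths G a b'), Set.range b' = Set.range b ∧
      ∀ i v, v ∈ (D.walk i).support → v ∉ Set.range b →
        (D.walk i).toSubgraph.Adj v (σ v) := by
  classical
  have hex : ∀ i, ∃ k, σ^[k] (a i) ∈ Set.range b := by
    intro i
    refine ⟨orderOf σ - 1, i, σ.injective ?_⟩
    rw [hσ, ← Function.iterate_succ_apply' σ, Nat.succ_eq_add_one,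
      Nat.sub_add_cancel (orderOf_pos σ), Equiv.Perm.iterate_eq_pow, pow_orderOf_eq_one]
    rfl
  let k : ι → ℕ := fun i => Nat.find (hex i)
  have hk : ∀ i, σ^[k i] (a i) ∈ Set.range b := fun i => Nat.find_spec (hex i)
  have hlt : ∀ i l, l < k i → σ^[l] (a i) ∉ Set.range b := fun i l hl => Nat.find_min (hex i) hl
  -- The predecessor of `a j` is `b j`, so no path runs through a start vertex.
  have hstart : ∀ i j l, l ≤ k i → σ^[l] (a i) = a j → l = 0 := by
    intro i j l hl h
    cases l with
    | zero => rfl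
    | succ l =>
      rw [Function.iterate_succ_apply', ← hσ j] at h
      exact absurd ⟨j, (σ.injective h).symm⟩ (hlt i l (by omega))
  have hmeet : ∀ i j l m, l ≤ m → m ≤ k j → σ^[l] (a i) = σ^[m] (a j) → i = j ∧ l = m := by
    intro i j l m hlm hm h
    obtain ⟨d, rfl⟩ := Nat.exists_eq_add_of_le hlm
    rw [Function.iterate_add_apply] at h
    have h' := σ.injective.iterate l h
    obtain rfl := hstart j i d (by omega) h'.symm
    exact ⟨ha h', rfl⟩
  have hmeet' : ∀ i j l m, l ≤ k i → m ≤ k j → σ^[l] (a i) = σ^[m] (a j) → i = j ∧ l = m := by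
    intro i j l m hl hm h
    rcases le_total l m with hlm | hml
    · exact hmeet i j l m hlm hm h
    · obtain ⟨h1, h2⟩ := hmeet j i m l hml hl h.symm
      exact ⟨h1.symm, h2.symm⟩
  have hstep : ∀ i, ∀ l < k i, G.Adj (σ^[l] (a i)) (σ^[l + 1] (a i)) := by
    intro i l hl
    rw [Function.iterate_succ_apply']
    refine (hadj _ (hlt i l hl)).resolve_left fun h => ?_
    rw [← Function.iterate_succ_apply' σ] at h
    have := (hmeet' i i (l + 1) l hl hl.le h).2
    omega
  choose p hlen hget using fun i => G.exists_walk_iterate σ (k i) (a i) (hstep i)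
  have hsupp : ∀ i v, v ∈ (p i).support ↔ ∃ l ≤ k i, σ^[l] (a i) = v := by
    intro i v
    rw [SimpleGraph.Walk.mem_support_iff_exists_getVert]
    constructor
    · rintro ⟨l, hl, hle⟩
      rw [hlen] at hle
      exact ⟨l, hle, by rw [← hget i l hle, hl]⟩
    · rintro ⟨l, hle, hl⟩
      exact ⟨l, by rw [hget i l hle, hl], by rwa [hlen]⟩
  have hpath : ∀ i, (p i).IsPath := by
    intro i
    rw [← SimpleGraph.Walk.IsPath.getVert_injOn_iff]
    intro l hl m hm h
    have hl' : l ≤ k i := (hlen i).le.trans' hl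
    have hm' : m ≤ k i := (hlen i).le.trans' hm
    rw [hget i l hl', hget i m hm'] at h
    exact (hmeet' i i l m hl' hm' h).2
  have hdisj : ∀ {i j v}, v ∈ (p i).support → v ∈ (p j).support → i = j := by
    intro i j v hi hj
    obtain ⟨l, hl, rfl⟩ := (hsupp i _).1 hi
    obtain ⟨m, hm, h⟩ := (hsupp j _).1 hj
    exact (hmeet' j i m l hm hl h).1.symm
  refine ⟨fun i => σ^[k i] (a i), ⟨p, hpath, hdisj⟩, ?_, ?_⟩
  · -- The ends are `|ι|` distinct members of the range of `b`.
    choose g hg using hk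
    have hginj : Function.Injective g := by
      intro i j h
      have : σ^[k i] (a i) = σ^[k j] (a j) := by rw [← hg, ← hg, h]
      exact (hmeet' i j _ _ le_rfl le_rfl this).1
    have hgsurj := Finite.surjective_of_injective hginj
    have : (fun i => σ^[k i] (a i)) = b ∘ g := funext fun i => (hg i).symm
    rw [this, hgsurj.range_comp]
  · intro i v hv hvb
    obtain ⟨l, hl, rfl⟩ := (hsupp i v).1 hv
    have hl' : l < k i := lt_of_le_of_ne hl fun h => hvb (h ▸ hk i)
    have h := (p i).toSubgraph_adj_getVert (hl'.trans_eq (hlen i).symm)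
    rwa [hget i l hl, hget i (l + 1) hl', Function.iterate_succ_apply'] at h

/-- Rigidity, expressed through permutations: a permutation that sends each `b i` to `a i` and
moves every other vertex along an edge or not at all traces a linkage with the same ends, hence
the given one, and so it follows each path of the family from start to end. -/
theorem perm_getVert_of_rigid [Finite ι] [Finite V]
    (hrigid : ∀ Q : G.Subgraph, IsLinkageBetween Q (Set.range a) (Set.range b) →
      Q = D.toSubgraph)
    (σ : Equiv.Perm V) (hσ : ∀ i, σ (b i) = a i)
    (hadj : ∀ v, v ∉ Set.range b → σ v = v ∨ G.Adj v (σ v)) (i : ι) (k : ℕ)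
    (hk : k < (D.walk i).length) :
    σ ((D.walk i).getVert k) = (D.walk i).getVert (k + 1) := by
  obtain ⟨b', D', hb', htr⟩ :=
    exists_disjointPaths_of_perm D.start_injective σ hσ hadj
  have hQ : D'.toSubgraph = D.toSubgraph := hrigid _ (hb' ▸ D'.isLinkageBetween)
  have hinj := (D.isPath i).getVert_injOn
  have hnb : ∀ l < (D.walk i).length, (D.walk i).getVert l ∉ Set.range b := by
    rintro l hl ⟨j, hj⟩
    obtain rfl : i = j := D.disjoint ((D.walk i).getVert_mem_support l)
      (hj ▸ (D.walk j).end_mem_support)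
    have h := hinj (Set.mem_ofPred.2 (le_refl (D.walk i).length)) hl.le
      ((D.walk i).getVert_length.trans hj)
    omega
  have hedge : ∀ l < (D.walk i).length,
      (D.walk i).toSubgraph.Adj ((D.walk i).getVert l) (σ ((D.walk i).getVert l)) := by
    intro l hl
    have hs := (D.walk i).getVert_mem_support l
    obtain ⟨j, hj⟩ := D'.mem_verts.1 (hQ ▸ D.mem_verts.2 ⟨i, hs⟩)
    exact D.adj_of_mem hs (hQ ▸ D'.adj_iff.2 ⟨j, htr j _ hj (hnb l hl)⟩)
  -- Each vertex has at most two neighbours on its path, and the previous one is already the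
  -- image of an earlier vertex, or of the end vertex.
  induction k using Nat.strong_induction_on with
  | h k ih =>
    rcases Nat.eq_zero_or_pos k with rfl | hpos
    · have hnil : ¬ (D.walk i).Nil := SimpleGraph.Walk.not_nil_iff_lt_length.2 hk
      have h : σ (a i) ∈ (D.walk i).toSubgraph.neighborSet (a i) := by
        simpa using hedge 0 hk
      rw [(D.isPath i).neighborSet_toSubgraph_startpoint hnil] at h
      simpa using h
    have h : σ ((D.walk i).getVert k) ∈
        (D.walk i).toSubgraph.neighborSet ((D.walk i).getVert k) := hedge k hk
    rw [(D.isPath i).neighborSet_toSubgraph_internal (by omega) hk] at h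
    refine h.resolve_left fun h => ?_
    obtain rfl | ⟨l, rfl⟩ : k = 1 ∨ ∃ l, k = l + 2 := by
      rcases k with _ | _ | l
      · omega
      · exact Or.inl rfl
      · exact Or.inr ⟨l, rfl⟩
    · rw [Nat.sub_self, SimpleGraph.Walk.getVert_zero] at h
      exact hnb 1 hk ⟨i, (σ.injective (h.trans (hσ i).symm)).symm⟩
    · rw [show l + 2 - 1 = l + 1 from rfl, ← ih l (by omega) (by omega)] at h
      have h1 : l + 2 ≤ (D.walk i).length := hk.le
      have h2 : l ≤ (D.walk i).length := by omega
      have := hinj h1 h2 (σ.injective h)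
      omega

end DisjointPaths

end RigidLinkage

namespace RigidLinkage

variable {V : Type*} {G : SimpleGraph V}

/-! ### The bound for a single rigid linkage -/

open Polynomial in
/-- For a rigid linkage, the minor of `X - A` cut out by its two sets of ends has degree exactly
the number of vertices off the linkage, because only permutations that follow the linkage
contribute, and among those only one is the identity elsewhere. -/
theorem DisjointPaths.exists_natDegree_det_borderedCharmatrix [Fintype V] [DecidableEq V]
    {ι : Type*} [Fintype ι] {a b : ι → V} (D : DisjointPaths G a b)
    (hrigid : ∀ Q : G.Subgraph, IsLinkageBetween Q (Set.range a) (Set.range b) →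
      Q = D.toSubgraph)
    {A : Matrix V V ℝ} (hA : A ∈ symmetricMatrices G) :
    ∃ f : V → V, (borderedCharmatrix A (Finset.univ.image b) f).det ≠ 0 ∧
      (borderedCharmatrix A (Finset.univ.image b) f).det.natDegree +
        D.toSubgraph.verts.ncard = Fintype.card V := by
  classical
  obtain ⟨π, hπb, hπw, hπo⟩ := D.exists_closingPerm
  let s : Finset V := Finset.univ.image b
  have hs : ∀ v, v ∈ s ↔ v ∈ Set.range b := by simp [s]
  let N := borderedCharmatrix A s π
  have hN : ∀ v w, N v w = if v ∈ s then if w = π v then 1 else 0 else A.charmatrix v w :=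
    fun v w => rfl
  let U : Finset V := Finset.univ.filter fun v => ∀ i, v ∉ (D.walk i).support
  have hU : ∀ v, v ∈ U ↔ ∀ i, v ∉ (D.walk i).support := by simp [U]
  have hUs : ∀ v ∈ U, v ∉ s := by
    intro v hv hvs
    obtain ⟨i, rfl⟩ := (hs v).1 hvs
    exact (hU _).1 hv i (D.walk i).end_mem_support
  have hinner : ∀ v, v ∉ U → v ∉ s →
      ∃ i k, k < (D.walk i).length ∧ (D.walk i).getVert k = v := by
    intro v hv hvs
    rw [hU] at hv
    push Not at hv
    obtain ⟨i, hi⟩ := hv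
    obtain ⟨k, hk, hle⟩ := SimpleGraph.Walk.mem_support_iff_exists_getVert.1 hi
    refine ⟨i, k, lt_of_le_of_ne hle ?_, hk⟩
    rintro rfl
    rw [SimpleGraph.Walk.getVert_length] at hk
    exact hvs ((hs v).2 ⟨i, hk⟩)
  have hπadj : ∀ v, v ∉ U → v ∉ s → G.Adj v (π v) := by
    intro v hv hvs
    obtain ⟨i, k, hk, rfl⟩ := hinner v hv hvs
    rw [hπw i k hk]
    exact (D.walk i).adj_getVert_succ hk
  -- The permutations contributing to the determinant are those tracing the linkage.
  have hagree : ∀ σ : Equiv.Perm V, ∏ v, N v (σ v) ≠ 0 → ∀ v, v ∉ U → σ v = π v := by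
    intro σ hσ
    have hne : ∀ v, N v (σ v) ≠ 0 := fun v => Finset.prod_ne_zero_iff.1 hσ v (Finset.mem_univ v)
    have hσs : ∀ v ∈ s, σ v = π v := by
      intro v hv
      have h := hne v
      rw [hN, if_pos hv] at h
      by_contra hc
      exact h (if_neg hc)
    have hσadj : ∀ v, v ∉ Set.range b → σ v = v ∨ G.Adj v (σ v) := by
      intro v hv
      have h := hne v
      rw [hN, if_neg fun hvs => hv ((hs v).1 hvs)] at h
      refine or_iff_not_imp_left.2 fun hvσ => ?_
      rw [Matrix.charmatrix_apply_ne _ _ _ (Ne.symm hvσ), neg_ne_zero, Ne, C_eq_zero] at h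
      exact (hA.2 v (σ v) (Ne.symm hvσ)).1 h
    intro v hv
    by_cases hvs : v ∈ s
    · exact hσs v hvs
    · obtain ⟨i, k, hk, rfl⟩ := hinner v hv hvs
      rw [hπw i k hk]
      exact D.perm_getVert_of_rigid hrigid σ
        (fun i => (hσs _ ((hs _).2 ⟨i, rfl⟩)).trans (hπb i)) hσadj i k hk
  have hentry : ∀ σ : Equiv.Perm V, (∀ v, v ∉ U → σ v = π v) → ∀ v,
      (N v (σ v)).natDegree = if v ∈ U ∧ σ v = v then 1 else 0 := by
    intro σ hσ v
    rw [hN]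
    by_cases hvs : v ∈ s
    · rw [if_pos hvs, if_neg (c := v ∈ U ∧ σ v = v) fun h => hUs v h.1 hvs]
      split_ifs <;> simp
    · rw [if_neg hvs, Matrix.charmatrix_apply_natDegree]
      by_cases hv : v ∈ U
      · simp [hv, eq_comm]
      · have h := (hπadj v hv hvs).ne
        rw [← hσ v hv] at h
        simp [hv, h]
  have hdeg : ∀ σ : Equiv.Perm V, ∏ v, N v (σ v) ≠ 0 →
      (∏ v, N v (σ v)).natDegree = (U.filter fun v => σ v = v).card := by
    intro σ hσ
    rw [natDegree_prod _ _ fun v _ => Finset.prod_ne_zero_iff.1 hσ v (Finset.mem_univ v),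
      Finset.sum_congr rfl fun v _ => hentry σ (hagree σ hσ) v, ← Finset.card_filter]
    congr 1
    ext v
    simp
  have hlt : ∀ σ : Equiv.Perm V, σ ≠ π → ∏ v, N v (σ v) ≠ 0 →
      (∏ v, N v (σ v)).natDegree < U.card := by
    intro σ hne hσ
    rw [hdeg σ hσ]
    obtain ⟨v, hv⟩ := not_forall.1 (mt Equiv.ext hne)
    have hvU : v ∈ U := by
      by_contra h
      exact hv (hagree σ hσ v h)
    refine Finset.card_lt_card (Finset.filter_ssubset.2 ⟨v, hvU, fun h => hv ?_⟩)
    rw [h, hπo v ((hU v).1 hvU)]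
  have hπ0 : ∏ v, N v (π v) ≠ 0 := by
    refine Finset.prod_ne_zero_iff.2 fun v _ => ?_
    rw [hN]
    by_cases hvs : v ∈ s
    · simp [hvs]
    rw [if_neg hvs]
    by_cases hv : v ∈ U
    · rw [hπo v ((hU v).1 hv), Matrix.charmatrix_apply_eq]
      exact X_sub_C_ne_zero _
    · have h := hπadj v hv hvs
      rw [Matrix.charmatrix_apply_ne _ _ _ h.ne, neg_ne_zero, Ne, C_eq_zero]
      exact (hA.2 _ _ h.ne).2 h
  have hπdeg : (∏ v, N v (π v)).natDegree = U.card := by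
    rw [hdeg π hπ0, Finset.filter_true_of_mem fun v hv => hπo v ((hU v).1 hv)]
  have hdet : ∀ m, N.det.coeff m =
      ∑ σ : Equiv.Perm V, ((Equiv.Perm.sign σ : ℤ) : ℝ) * (∏ v, N v (σ v)).coeff m := by
    intro m
    rw [← Matrix.det_transpose, Matrix.det_apply', finsetSum_coeff]
    refine Finset.sum_congr rfl fun σ _ => ?_
    rw [coeff_intCast_mul]
    rfl
  have hcoeff : N.det.coeff U.card ≠ 0 := by
    rw [hdet, Finset.sum_eq_single π]
    · rw [← hπdeg]
      refine mul_ne_zero ?_ (leadingCoeff_ne_zero.2 hπ0)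
      exact_mod_cast (Equiv.Perm.sign π).ne_zero
    · intro σ _ hne
      by_cases hσ : ∏ v, N v (σ v) = 0
      · simp [hσ]
      · rw [coeff_eq_zero_of_natDegree_lt (hlt σ hne hσ), mul_zero]
    · simp
  have hle : N.det.natDegree ≤ U.card := by
    refine natDegree_le_iff_coeff_eq_zero.2 fun m hm => ?_
    rw [hdet]
    refine Finset.sum_eq_zero fun σ _ => ?_
    by_cases hσ : ∏ v, N v (σ v) = 0
    · simp [hσ]
    · rw [coeff_eq_zero_of_natDegree_lt, mul_zero]
      rw [hdeg σ hσ]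
      exact (Finset.card_filter_le _ _).trans_lt hm
  refine ⟨π, fun h => hcoeff (by rw [show N.det = 0 from h, coeff_zero]), ?_⟩
  have hnat : N.det.natDegree = U.card := le_antisymm hle (le_natDegree_of_ne_zero hcoeff)
  have hverts : D.toSubgraph.verts.ncard = Uᶜ.card := by
    rw [← Set.ncard_coe_finset]
    congr 1
    ext v
    rw [D.mem_verts, Finset.mem_coe, Finset.mem_compl, hU]
    push Not
    rfl
  rw [show (borderedCharmatrix A (Finset.univ.image b) π).det.natDegree = U.card from hnat,
    hverts, Finset.card_add_card_compl]

theorem IsRigid.ncard_verts_le [Fintype V] {P : G.Subgraph} (hP : IsRigid P)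
    {A : Matrix V V ℝ} (hA : A ∈ symmetricMatrices G) :
    P.verts.ncard ≤ ∑ μ ∈ eigenvalueFinset A, min (mult A μ) (order P) := by
  classical
  obtain ⟨-, α, β, hlink, hrigid⟩ := hP
  obtain ⟨a, b, D, hD, rfl, rfl⟩ := hlink.exists_disjointPaths
  have : Fintype P.coe.ConnectedComponent := Fintype.ofFinite _
  obtain ⟨f, h0, hdeg⟩ := D.exists_natDegree_det_borderedCharmatrix
    (fun Q hQ => (hrigid Q hQ).trans hD.symm) hA
  rw [hD] at hdeg
  have hcard : (Finset.univ.image b).card = order P := by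
    rw [Finset.card_image_of_injective _ D.end_injective, Finset.card_univ, order,
      Nat.card_eq_fintype_card]
  have h1 := sum_mult_sub_card_le_natDegree A _ f h0
  rw [hcard] at h1
  have h2 := card_le_sum_mult hA.1
  have h3 : ∑ μ ∈ eigenvalueFinset A, mult A μ =
      ∑ μ ∈ eigenvalueFinset A, (mult A μ - order P) +
        ∑ μ ∈ eigenvalueFinset A, min (mult A μ) (order P) := by
    rw [← Finset.sum_add_distrib]
    exact Finset.sum_congr rfl fun μ _ => by omega
  omega

theorem RL_le_sum_min [Fintype V] (G : SimpleGraph V) (t : ℕ)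
    {A : Matrix V V ℝ} (hA : A ∈ symmetricMatrices G) :
    RL G t ≤ ∑ μ ∈ eigenvalueFinset A, min (mult A μ) t := by
  refine csSup_le' ?_
  rintro n ⟨P, hP, rfl, rfl⟩
  exact hP.ncard_verts_le hA

end RigidLinkage

theorem theorem3p6 {V : Type*} [Fintype V] (G : SimpleGraph V) (t : ℕ) (ht : 0 < t) :
    (∀ A ∈ RigidLinkage.symmetricMatrices G,
      RigidLinkage.RL G t ≤ ∑ j ∈ Finset.Icc 1 t, RigidLinkage.numEigenvaluesMultGE A j) ∧
    ⌈(RigidLinkage.RL G t : ℚ) / (t : ℚ)⌉₊ ≤ RigidLinkage.minNumEigenvalues G := by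
  constructor
  · intro A hA
    rw [RigidLinkage.sum_numEigenvaluesMultGE]
    exact RigidLinkage.RL_le_sum_min G t hA
  · obtain ⟨A, hA, hq⟩ := Nat.sInf_mem ((RigidLinkage.symmetricMatrices_nonempty G).image
      RigidLinkage.numEigenvalues)
    have h : RigidLinkage.RL G t ≤ RigidLinkage.numEigenvalues A * t := by
      rw [RigidLinkage.numEigenvalues_eq_card, ← smul_eq_mul]
      exact (RigidLinkage.RL_le_sum_min G t hA).trans
        (Finset.sum_le_card_nsmul _ _ _ fun μ _ => min_le_right _ _)
    rw [RigidLinkage.minNumEigenvalues, ← hq, Nat.ceil_le, div_le_iff₀ (by exact_mod_cast ht)]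
    exact_mod_cast h
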